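/- Let $m\ge 3$. For $\boldsymbol p=(p_0,\dots,p_{m-1})\in(0,1)^m$ let $X=(X_n)_{n\ge 0}$ be the cyclic birth–death chain with birth probabilities $\boldsymbol p$, that is, the Markov chain on $\mathbb Z$ which from state $i$ jumps to $i+1$ with probability $p_{i \bmod m}$ and to $i-1$ with probability $1-p_{i\bmod m}$. There is a deterministic real number $v(\boldsymbol p)$, the speed, such that $X_n/n\to v(\boldsymbol p)$ almost surely from every starting state. For a permutation $\sigma$ of $\{0,\dots,m-1\}$ write $\boldsymbol p_\sigma=(p_{\sigma^{-1}(i)})_{i=0}^{m-1}$, and let $N(\boldsymbol p)=\#\{v(\boldsymbol p_\sigma):\sigma \text{ a permutation of } \{0,\dots,m-1\}\}$ be the number of distinct speeds obtained by reordering $\boldsymbol p$. 1. For every $\boldsymbol p\in(0,1)^m$, we have $N(\boldsymbol p)\le \frac{(m-1)!}{2}$, and $v(\boldsymbol p_\sigma)=v(\boldsymbol p)$ for every $\sigma$ that is a composition of rotations and reversals of $\{0,\dots,m-1\}$. 2. For Lebesgue-almost every $\boldsymbol p\in(0,1)^m$, we have $N(\boldsymbol p)=\frac{(m-1)!}{2}$,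 and $v(\boldsymbol p_\sigma)=v(\boldsymbol p)$ only if $\sigma$ is a composition of rotations and reversals. -/

import Mathlib

open MeasureTheory ProbabilityTheory Filter Topology
open scoped Nat

namespace CyclicBD

/-- The residue of an integer modulo `m`, as an index in `{0, …, m - 1}`. -/
def residue (m : ℕ) [NeZero m] (i : ℤ) : Fin m :=
  ⟨(i % (m : ℤ)).toNat, by
    have hm : (0 : ℤ) < m := by exact_mod_cast Nat.pos_of_ne_zero (NeZero.ne m)
    have h1 := Int.emod_nonneg i hm.ne'
    have h2 := Int.emod_lt_of_pos i hm
    omega⟩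

variable {m : ℕ} [NeZero m]

/-- The one-step law of the cyclic birth–death chain from the state `i`: up to `i + 1` with
probability `p (i mod m)`, down to `i - 1` with probability `1 - p (i mod m)`. -/
noncomputable def stepLaw (p : Fin m → Set.Ioo (0 : ℝ) 1) (i : ℤ) : Measure ℤ :=
  ENNReal.ofReal (p (residue m i)) • Measure.dirac (i + 1) +
    ENNReal.ofReal (1 - p (residue m i)) • Measure.dirac (i - 1)

instance (p : Fin m → Set.Ioo (0 : ℝ) 1) (i : ℤ) : IsProbabilityMeasure (stepLaw p i) := by
  constructor
  have h := (p (residue m i)).2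
  simp only [stepLaw, Measure.add_apply, Measure.smul_apply, measure_univ, smul_eq_mul, mul_one]
  rw [← ENNReal.ofReal_add h.1.le (by linarith [h.2])]
  simp

/-- The transition kernel of the cyclic birth–death chain on `ℤ`. -/
noncomputable def stepKernel (p : Fin m → Set.Ioo (0 : ℝ) 1) : Kernel ℤ ℤ where
  toFun := stepLaw p
  measurable' := measurable_of_countable _

instance (p : Fin m → Set.Ioo (0 : ℝ) 1) : IsMarkovKernel (stepKernel p) :=
  ⟨fun i => inferInstanceAs (IsProbabilityMeasure (stepLaw p i))⟩

/-- The conditional law of `X (n + 1)` given the history `X 0, …, X n`: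
it depends only on `X n` (Markov property), through the transition kernel. -/
noncomputable def historyKernel (p : Fin m → Set.Ioo (0 : ℝ) 1) (n : ℕ) :
    Kernel (Finset.Iic n → ℤ) ℤ :=
  (stepKernel p).comap (fun h => h ⟨n, Finset.mem_Iic.2 le_rfl⟩) (measurable_pi_apply _)

instance (p : Fin m → Set.Ioo (0 : ℝ) 1) (n : ℕ) : IsMarkovKernel (historyKernel p n) := by
  unfold historyKernel; infer_instance

/-- The law, on the space of trajectories `ℕ → ℤ`, of the cyclic birth–death chain with birth
probabilities `p` started from the state `x`. -/
noncomputable def chainLaw (p : Fin m → Set.Ioo (0 : ℝ) 1) (x : ℤ) : Measure (ℕ → ℤ) :=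
  Kernel.trajMeasure (X := fun _ => ℤ) (Measure.dirac x) (historyKernel p)

/-- The chain with birth probabilities `p` has the deterministic speed `v`: from every starting
state, `X n / n → v` almost surely. -/
def HasSpeed (p : Fin m → Set.Ioo (0 : ℝ) 1) (v : ℝ) : Prop :=
  ∀ x : ℤ, ∀ᵐ X ∂(chainLaw p x), Tendsto (fun n : ℕ => (X n : ℝ) / (n : ℝ)) atTop (𝓝 v)

open Classical in
/-- The speed `v(p)` of the chain (there is at most one `v` with `HasSpeed p v`; the value is `0`
by convention if there is none). -/
noncomputable def speed (p : Fin m → Set.Ioo (0 : ℝ) 1) : ℝ :=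
  if h : ∃ v : ℝ, HasSpeed p v then h.choose else 0

/-- The reordered vector `p_σ`, whose `i`-th entry is `p (σ⁻¹ i)`. -/
def reorder (σ : Equiv.Perm (Fin m)) (p : Fin m → Set.Ioo (0 : ℝ) 1) :
    Fin m → Set.Ioo (0 : ℝ) 1 :=
  fun i => p (σ⁻¹ i)

/-- The number `N(p)` of distinct speeds obtained by reordering the entries of `p`. -/
noncomputable def numSpeeds (p : Fin m → Set.Ioo (0 : ℝ) 1) : ℕ :=
  Set.ncard (Set.range fun σ : Equiv.Perm (Fin m) => speed (reorder σ p))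

/-- The permutations of `{0, …, m - 1}` that are compositions of rotations and reversals. -/
def rotationsAndReversals (m : ℕ) : Subgroup (Equiv.Perm (Fin m)) :=
  Subgroup.closure {finRotate m, Fin.revPerm}

end CyclicBD

/-!
The speed has the closed form `v = m (∏ p - ∏ (1 - p)) / W`, where `W` (`totalWeight`) is a
polynomial in the birth probabilities indexed by `ℤ / m`.

To see this, one solves the Poisson equation `P u - u = v` on `ℤ` by a perturbation `u` of the
identity by a periodic function: the increments of `u` are periodic, their recursion is
`weight_recursion`, and they must have sum `m` over a period. Then `u (X n) - n v` is a martingale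
with bounded increments; its fourth moments are `O(n²)` (`lintegral_pow_four_le`), so by
summability it is `o(n)` almost surely (`ae_tendsto_martingale_div`), and `X n / n → v`.
No distinction between drift upwards, drift downwards and recurrence is needed.

The products in the numerator do not depend on the order of the entries, and `W` is a sum over all
cyclic intervals of the product with death factors inside and birth factors outside
(`totalWeight_eq_sum_arcProd`), hence invariant under rotations and reversals. These form a group
of order `2 m`, so there are at most `m! / (2 m)` speeds.

Conversely, evaluate `W` at the vector that is `0` on a two-element set and `1` elsewhere: the value
is nonzero exactly when the two elements are adjacent on the cycle. So a permutation under which the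
polynomial `W` is invariant preserves adjacency, and is a rotation or a reflection
(`exists_affine_of_totalWeight_comp`). For every other permutation the two values of `W` differ
outside the zero set of a nonzero polynomial, which is Lebesgue-null
(`MvPolynomial.ae_eval_ne_zero`); also `∏ p ≠ ∏ (1 - p)` almost everywhere, so the speeds differ.
-/

/-! ### Cyclic weights -/

namespace CyclicBD

section Weights

variable {m : ℕ} [NeZero m] {R : Type*} [CommRing R]

/-- The identification of `{0, …, m - 1}` with `ℤ / m`, sending `i` to its class. -/
def toZMod (m : ℕ) [NeZero m] : Fin m ≃ ZMod m where
  toFun i := ((i : ℕ) : ZMod m)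
  invFun z := ⟨z.val, ZMod.val_lt z⟩
  left_inv i := Fin.ext (ZMod.val_cast_of_lt i.2)
  right_inv z := ZMod.natCast_zmod_val z

lemma toZMod_apply (i : Fin m) : toZMod m i = ((i : ℕ) : ZMod m) := rfl

lemma residue_eq_toZMod_symm (i : ℤ) : residue m i = (toZMod m).symm (i : ZMod m) := by
  apply Fin.ext
  have h : (((i : ZMod m).val : ℕ) : ℤ) = i % m := ZMod.val_intCast i
  simp only [residue, toZMod, Equiv.coe_fn_symm_mk]
  omega

lemma prod_range_natCast (f : ZMod m → R) : ∏ j ∈ Finset.range m, f j = ∏ z, f z := by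
  rw [Finset.prod_range]
  exact Equiv.prod_comp (toZMod m) f

lemma prod_range_sub_natCast (f : ZMod m → R) (i : ZMod m) :
    ∏ j ∈ Finset.range m, f (i - j) = ∏ z, f z := by
  rw [prod_range_natCast (fun z => f (i - z))]
  exact Equiv.prod_comp (Equiv.subLeft i) f

lemma sum_range_natCast (f : ZMod m → R) : ∑ j ∈ Finset.range m, f j = ∑ z, f z := by
  rw [Finset.sum_range]
  exact Equiv.sum_comp (toZMod m) f

/-- Up to normalisation, the expected time that the chain with birth probabilities `a` on
`ℤ / m` needs to go from `i` to `i + 1` (when it drifts upwards). The `k`-th term has death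
factors at `i, i - 1, …, i - k + 1`, no factor at `i - k`, and birth factors at the remaining
places. The definition makes sense over any ring, so that it also yields polynomials. -/
def weight (a : ZMod m → R) (i : ZMod m) : R :=
  ∑ k ∈ Finset.range m, (∏ j ∈ Finset.range k, (1 - a (i - j))) *
    ∏ j ∈ Finset.Ico (k + 1) m, a (i - j)

/-- The sum of the weights over a period; the speed is inversely proportional to it. -/
def totalWeight (a : ZMod m → R) : R := ∑ i, weight a i

/-- The weights solve the recursion satisfied by the increments of a harmonic coordinate. -/
lemma weight_recursion (a : ZMod m → R) (i : ZMod m) :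
    a i * weight a i - (1 - a i) * weight a (i - 1) = ∏ z, a z - ∏ z, (1 - a z) := by
  set T : ℕ → R := fun k => (∏ j ∈ Finset.range k, (1 - a (i - j))) *
    ∏ j ∈ Finset.Ico (k + 1) (m + 1), a (i - j) with hT
  have h1 : a i * weight a i = ∑ k ∈ Finset.range m, T k := by
    rw [weight, Finset.mul_sum]
    refine Finset.sum_congr rfl fun k hk => ?_
    have hk' : k + 1 ≤ m := Finset.mem_range.1 hk
    simp only [hT]
    rw [Finset.prod_Ico_succ_top hk']
    simp only [CharP.cast_eq_zero, sub_zero]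
    ring
  have h2 : (1 - a i) * weight a (i - 1) = ∑ k ∈ Finset.range m, T (k + 1) := by
    rw [weight, Finset.mul_sum]
    refine Finset.sum_congr rfl fun k _ => ?_
    simp only [hT]
    rw [Finset.prod_range_succ', ← Finset.prod_Ico_add' (fun j : ℕ => a (i - j)) (k + 1) m 1]
    simp only [Nat.cast_zero, sub_zero, Nat.cast_add, Nat.cast_one, sub_sub, add_comm (1 : ZMod m)]
    ring
  have h3 : T 0 = ∏ z, a z := by
    simp only [hT, Finset.range_zero, Finset.prod_empty, one_mul]
    rw [← Finset.prod_Ico_add' (fun j : ℕ => a (i - j)) 0 m 1, ← Finset.range_eq_Ico,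
      ← prod_range_sub_natCast a (i - 1)]
    refine Finset.prod_congr rfl fun j _ => ?_
    push_cast
    congr 1
    ring
  have h4 : T m = ∏ z, (1 - a z) := by
    simp only [hT, Finset.Ico_self, Finset.prod_empty, mul_one]
    exact prod_range_sub_natCast (fun z => 1 - a z) i
  rw [h1, h2, ← Finset.sum_sub_distrib, Finset.sum_range_sub', h3, h4]

lemma map_totalWeight {S : Type*} [CommRing S] (f : R →+* S) (a : ZMod m → R) :
    f (totalWeight a) = totalWeight (fun z => f (a z)) := by
  simp only [totalWeight, weight, map_sum, map_mul, map_prod, map_sub, map_one]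

/-- The product with death factors on the cyclic interval `{i, i - 1, …, i - l + 1}` of length
`l` and birth factors elsewhere. -/
def arcProd (a : ZMod m → R) (i : ZMod m) (l : ℕ) : R :=
  (∏ j ∈ Finset.range l, (1 - a (i - j))) * ∏ j ∈ Finset.Ico l m, a (i - j)

/-- Inserting `1 = (1 - a) + a` at the missing place writes the total weight as a sum over
cyclic intervals, which is visibly invariant under the symmetries of the cycle. -/
lemma totalWeight_eq_sum_arcProd (a : ZMod m → R) :
    totalWeight a = ∑ k ∈ Finset.range m, ∑ i, (arcProd a i k + arcProd a i (k + 1)) := by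
  simp only [totalWeight, weight]
  rw [Finset.sum_comm]
  refine Finset.sum_congr rfl fun k hk => Finset.sum_congr rfl fun i _ => ?_
  simp only [arcProd]
  rw [Finset.prod_range_succ, Finset.prod_eq_prod_Ico_succ_bot (Finset.mem_range.1 hk)]
  ring

lemma totalWeight_comp_add (a : ZMod m → R) (c : ZMod m) :
    totalWeight (fun z => a (z + c)) = totalWeight a := by
  simp only [totalWeight]
  rw [← Equiv.sum_comp (Equiv.addRight c) (weight a)]
  refine Finset.sum_congr rfl fun i _ => ?_
  simp only [weight, Equiv.coe_addRight, sub_add_eq_add_sub]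

omit [NeZero m] in
lemma arcProd_comp_neg (a : ZMod m → R) (i : ZMod m) (l : ℕ) :
    arcProd (fun z => a (-z)) i l = arcProd a ((l : ZMod m) - 1 - i) l := by
  have hb : ∏ j ∈ Finset.range l, (1 - a (-(i - j))) =
      ∏ j ∈ Finset.range l, (1 - a ((l : ZMod m) - 1 - i - j)) := by
    rw [← Finset.prod_range_reflect]
    refine Finset.prod_congr rfl fun j hj => ?_
    have hj' : j + 1 ≤ l := Finset.mem_range.1 hj
    rw [Nat.sub_sub, add_comm 1 j, Nat.cast_sub hj']
    push_cast
    congr 2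
    ring
  have ha : ∏ j ∈ Finset.Ico l m, a (-(i - j)) =
      ∏ j ∈ Finset.Ico l m, a ((l : ZMod m) - 1 - i - j) := by
    refine Finset.prod_nbij' (fun j => l + m - 1 - j) (fun j => l + m - 1 - j) ?_ ?_ ?_ ?_ ?_ <;>
      intro j hj <;> rw [Finset.mem_Ico] at hj
    · rw [Finset.mem_Ico]; omega
    · rw [Finset.mem_Ico]; omega
    · omega
    · omega
    · rw [Nat.sub_sub, Nat.cast_sub (by omega)]
      push_cast
      congr 1
      rw [ZMod.natCast_self]
      ring
  simp only [arcProd, hb, ha]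

lemma totalWeight_comp_neg (a : ZMod m → R) :
    totalWeight (fun z => a (-z)) = totalWeight a := by
  rw [totalWeight_eq_sum_arcProd, totalWeight_eq_sum_arcProd]
  refine Finset.sum_congr rfl fun k _ => ?_
  rw [Finset.sum_add_distrib, Finset.sum_add_distrib]
  congr 1
  · simp only [arcProd_comp_neg a _ k]
    exact Equiv.sum_comp (Equiv.subLeft ((k : ZMod m) - 1)) (fun i => arcProd a i k)
  · simp only [arcProd_comp_neg a _ (k + 1)]
    exact Equiv.sum_comp (Equiv.subLeft (((k + 1 : ℕ) : ZMod m) - 1))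
      (fun i => arcProd a i (k + 1))

lemma weight_pos {a : ZMod m → ℝ} (h0 : ∀ z, 0 < a z) (h1 : ∀ z, a z < 1) (i : ZMod m) :
    0 < weight a i := by
  refine Finset.sum_pos (fun k _ => mul_pos (Finset.prod_pos fun j _ => sub_pos.2 (h1 _))
    (Finset.prod_pos fun j _ => h0 _)) (Finset.nonempty_range_iff.2 (NeZero.ne m))

end Weights

/-! ### Permutations preserving the total weight -/

section Rigidity

variable {m : ℕ} [NeZero m]

/-- The parameter that is `0` on `S` and `1` elsewhere. -/
noncomputable def vanishingOn (S : Set (ZMod m)) : ZMod m → ℝ := Sᶜ.indicator 1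

omit [NeZero m] in
open Classical in
lemma vanishingOn_apply (S : Set (ZMod m)) (z : ZMod m) :
    vanishingOn S z = if z ∈ S then 0 else 1 := by
  by_cases h : z ∈ S <;> simp [vanishingOn, h]

lemma totalWeight_vanishingOn_pos (hm : 3 ≤ m) (z : ZMod m) :
    0 < totalWeight (vanishingOn {z, z + 1}) := by
  classical
  have hnn : ∀ i, ∀ k ∈ Finset.range m,
      0 ≤ (∏ j ∈ Finset.range k, (1 - vanishingOn {z, z + 1} (i - (j : ZMod m)))) *
        ∏ j ∈ Finset.Ico (k + 1) m, vanishingOn {z, z + 1} (i - (j : ZMod m)) := by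
    intro i k _
    refine mul_nonneg (Finset.prod_nonneg fun j _ => ?_) (Finset.prod_nonneg fun j _ => ?_) <;>
      rw [vanishingOn_apply] <;> split_ifs <;> norm_num
  -- the term `i = z + 1`, `k = 2` equals `1`
  refine Finset.sum_pos' (fun i _ => Finset.sum_nonneg (hnn i))
    ⟨z + 1, Finset.mem_univ _, Finset.sum_pos' (hnn _) ⟨2, Finset.mem_range.2 hm, ?_⟩⟩
  refine mul_pos (Finset.prod_pos fun j hj => ?_) (Finset.prod_pos fun j hj => ?_)
  · rw [Finset.mem_range] at hj
    rw [vanishingOn_apply, if_pos]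
    · norm_num
    · interval_cases j <;> simp
  · rw [Finset.mem_Ico] at hj
    rw [vanishingOn_apply, if_neg]
    · norm_num
    · have key : ∀ t : ℕ, t < m → (j : ZMod m) = (t : ZMod m) → j = t := by
        intro t ht h
        have := congrArg ZMod.val h
        rwa [ZMod.val_cast_of_lt hj.2, ZMod.val_cast_of_lt ht] at this
      rintro (h | h)
      · have := key 1 (by omega) (by push_cast; linear_combination -h)
        omega
      · have := key 0 (by omega) (by push_cast; linear_combination -(Set.mem_singleton_iff.1 h))
        omega

/-- The total weight detects adjacency: if `a` vanishes exactly at `x` and `y`, a nonzero term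
forces `{x, y}` to be a cyclic interval. -/
lemma adjacent_of_totalWeight_vanishingOn_ne_zero {x y : ZMod m} (hxy : x ≠ y)
    (h : totalWeight (vanishingOn {x, y}) ≠ 0) : y - x = 1 ∨ y - x = -1 := by
  classical
  obtain ⟨i, -, hi⟩ := Finset.exists_ne_zero_of_sum_ne_zero h
  obtain ⟨k, hk, hik⟩ := Finset.exists_ne_zero_of_sum_ne_zero hi
  have hb := Finset.prod_ne_zero_iff.1 (left_ne_zero_of_mul hik)
  have ha := Finset.prod_ne_zero_iff.1 (right_ne_zero_of_mul hik)
  have hb' : ∀ j < k, i - (j : ZMod m) = x ∨ i - (j : ZMod m) = y := by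
    intro j hj
    by_contra hc
    refine hb j (Finset.mem_range.2 hj) ?_
    rw [vanishingOn_apply, if_neg (by simpa using hc), sub_self]
  have hpos : ∀ w : ZMod m, w = x ∨ w = y → ∃ j : ℕ, j ≤ k ∧ w = i - (j : ZMod m) := by
    intro w hw
    refine ⟨(i - w).val, ?_, by simp⟩
    by_contra! hc
    refine ha (i - w).val (Finset.mem_Ico.2 ⟨hc, ZMod.val_lt _⟩) ?_
    rw [vanishingOn_apply, if_pos]
    simpa using hw
  obtain ⟨s, hs, hxs⟩ := hpos x (Or.inl rfl)
  obtain ⟨t, ht, hyt⟩ := hpos y (Or.inr rfl)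
  have hkm : k < m := Finset.mem_range.1 hk
  have inj : ∀ r s : ℕ, r ≤ k → s ≤ k → i - (r : ZMod m) = i - (s : ZMod m) → r = s := by
    intro r s hr hs h
    have h2 : (r : ZMod m) = s := by linear_combination -h
    have := congrArg ZMod.val h2
    rwa [ZMod.val_cast_of_lt (by omega), ZMod.val_cast_of_lt (by omega)] at this
  have hst : s ≠ t := fun h => hxy (by rw [hxs, hyt, h])
  -- every offset below `k` is `s` or `t`
  have honly : ∀ j < k, j = s ∨ j = t := fun j hj => (hb' j hj).imp
    (fun h => inj j s hj.le hs (h.trans hxs)) (fun h => inj j t hj.le ht (h.trans hyt))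
  have hadj : s = t + 1 ∨ t = s + 1 := by
    rcases Nat.lt_or_gt_of_ne hst with h | h
    · right
      by_contra hc
      rcases honly (s + 1) (by omega) with h' | h' <;> omega
    · left
      by_contra hc
      rcases honly (t + 1) (by omega) with h' | h' <;> omega
  rcases hadj with h | h
  · left; rw [hxs, hyt, h]; push_cast; ring
  · right; rw [hxs, hyt, h]; push_cast; ring

/-- For `m ≥ 3`, an injective self-map of the `m`-cycle that preserves adjacency cannot turn
around, so it is a rotation or a reflection. -/
lemma exists_affine_of_adjacent (hm : 3 ≤ m) (π : Equiv.Perm (ZMod m))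
    (h : ∀ z, π (z + 1) - π z = 1 ∨ π (z + 1) - π z = -1) :
    ∃ (ε : ℤˣ) (c : ZMod m), ∀ z, π z = ((ε : ℤ) : ZMod m) * z + c := by
  have h2 : (2 : ZMod m) ≠ 0 := by
    intro h
    have h' : ((2 : ℕ) : ZMod m) = 0 := by exact_mod_cast h
    have := Nat.le_of_dvd (by norm_num) ((ZMod.natCast_eq_zero_iff 2 m).1 h')
    omega
  have hstep : ∀ z, π (z + 1 + 1) - π (z + 1) = π (z + 1) - π z := by
    intro z
    have hne : π (z + 1 + 1) ≠ π z := by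
      intro he
      exact h2 (by linear_combination π.injective he)
    rcases h z with h0 | h0 <;> rcases h (z + 1) with h1 | h1
    · rw [h0, h1]
    · exact absurd (by linear_combination h0 + h1) hne
    · exact absurd (by linear_combination h0 + h1) hne
    · rw [h0, h1]
  obtain ⟨ε, hε⟩ : ∃ ε : ℤˣ, π (0 + 1) - π 0 = ((ε : ℤ) : ZMod m) := by
    rcases h 0 with h0 | h0
    · exact ⟨1, by simpa using h0⟩
    · exact ⟨-1, by simpa using h0⟩
  have hconst : ∀ n : ℕ, π ((n : ZMod m) + 1) - π n = ((ε : ℤ) : ZMod m) := by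
    intro n
    induction n with
    | zero => simpa using hε
    | succ n ih => push_cast; rw [hstep, ih]
  have hlin : ∀ n : ℕ, π (n : ZMod m) = ((ε : ℤ) : ZMod m) * n + π 0 := by
    intro n
    induction n with
    | zero => simp
    | succ n ih => push_cast; linear_combination hconst n + ih
  refine ⟨ε, π 0, fun z => ?_⟩
  simpa using hlin z.val

lemma exists_affine_of_totalWeight_comp (hm : 3 ≤ m) (π : Equiv.Perm (ZMod m))
    (h : ∀ a : ZMod m → ℝ, totalWeight (fun z => a (π z)) = totalWeight a) :
    ∃ (ε : ℤˣ) (c : ZMod m), ∀ z, π z = ((ε : ℤ) : ZMod m) * z + c := by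
  have : Fact (1 < m) := ⟨by omega⟩
  refine exists_affine_of_adjacent hm π fun z => ?_
  refine adjacent_of_totalWeight_vanishingOn_ne_zero
    (fun he => one_ne_zero (by linear_combination -(π.injective he))) ?_
  rw [← h]
  convert (totalWeight_vanishingOn_pos hm z).ne' using 2
  ext w
  classical
  simp [vanishingOn_apply]

end Rigidity

end CyclicBD

/-! ### Zero sets of polynomials -/

namespace MvPolynomial

/-- The zero set of a nonzero real polynomial in several variables is Lebesgue-null: by Fubini
and induction, since a nonzero polynomial in one variable has finitely many roots. -/
theorem ae_eval_ne_zero {n : ℕ} {P : MvPolynomial (Fin n) ℝ} (hP : P ≠ 0) :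
    ∀ᵐ x : Fin n → ℝ, eval x P ≠ 0 := by
  induction n with
  | zero =>
    obtain ⟨x, hx⟩ : ∃ x, eval x P ≠ 0 := by
      by_contra! h
      exact hP (funext fun x => by simpa using h x)
    exact Eventually.of_forall fun y => by rwa [Subsingleton.elim y x]
  | succ n ih =>
    set Q := finSuccEquiv ℝ n P with hQ
    have hQ0 : Q ≠ 0 := by simpa [hQ] using hP
    have hmeas : MeasurableSet {z : ℝ × (Fin n → ℝ) |
        eval (Fin.cons z.1 z.2 : Fin (n + 1) → ℝ) P ≠ 0} := by
      have hc : Continuous fun z : ℝ × (Fin n → ℝ) =>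
          eval (Fin.cons z.1 z.2 : Fin (n + 1) → ℝ) P :=
        (continuous_eval P).comp
          (continuous_pi (Fin.cases (by simpa using continuous_fst)
            fun i => (continuous_apply i).comp continuous_snd))
      exact (isOpen_ne.preimage hc).measurableSet
    have key : ∀ᵐ z : ℝ × (Fin n → ℝ), eval (Fin.cons z.1 z.2 : Fin (n + 1) → ℝ) P ≠ 0 := by
      rw [Measure.volume_eq_prod, Measure.ae_prod_iff_ae_ae hmeas, Measure.ae_ae_comm hmeas]
      have hlead : Q.leadingCoeff ≠ 0 := Polynomial.leadingCoeff_ne_zero.2 hQ0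
      filter_upwards [ih hlead] with y hy
      have hmap : Q.map (eval y) ≠ 0 := fun h0 => hy (by
        simpa [Polynomial.coeff_map] using congrArg (fun q => q.coeff Q.natDegree) h0)
      have hfin : {t : ℝ | (Q.map (eval y)).IsRoot t}.Finite := by
        simpa using Polynomial.finite_setOfPred_isRoot hmap
      have := hfin.measure_zero (volume : Measure ℝ)
      filter_upwards [compl_mem_ae_iff.2 this] with t ht h0
      refine ht ?_
      simp only [Set.mem_ofPred_eq, Polynomial.IsRoot]
      rwa [eval_eq_eval_mv_eval'] at h0
    have hmp := (volume_preserving_piFinSuccAbove (fun _ : Fin (n + 1) => ℝ) 0)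
    have := hmp.quasiMeasurePreserving.ae key
    filter_upwards [this] with x hx
    convert hx using 2
    simp [MeasurableEquiv.piFinSuccAbove, Fin.insertNthEquiv]

end MvPolynomial

/-! ### Counting values constant on cosets -/

section Cosets

variable {G α : Type*} [Group G] [Finite G] (H : Subgroup G) (f : G → α)

lemma ncard_range_mul_card_le (hf : ∀ h ∈ H, ∀ g, f (h * g) = f g) :
    (Set.range f).ncard * Nat.card H ≤ Nat.card G := by
  have hwd : ∀ x y : G, QuotientGroup.leftRel H x y → f x⁻¹ = f y⁻¹ := by
    intro x y hxy
    rw [QuotientGroup.leftRel_apply] at hxy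
    rw [← hf _ hxy y⁻¹]
    simp
  have hr : Set.range f = Set.range (Quotient.lift (fun g => f g⁻¹) hwd) := by
    ext v
    constructor
    · rintro ⟨g, rfl⟩
      exact ⟨Quotient.mk _ g⁻¹, by simp⟩
    · rintro ⟨q, rfl⟩
      induction q using Quotient.inductionOn with
      | h g => exact ⟨g⁻¹, rfl⟩
  rw [Subgroup.card_eq_card_quotient_mul_card_subgroup H, hr, ← Nat.card_coe_set_eq]
  exact Nat.mul_le_mul_right _ (Finite.card_range_le _)

lemma ncard_range_mul_card_eq (hf : ∀ h ∈ H, ∀ g, f (h * g) = f g)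
    (hinj : ∀ g g', f g = f g' → g * g'⁻¹ ∈ H) :
    (Set.range f).ncard * Nat.card H = Nat.card G := by
  refine le_antisymm (ncard_range_mul_card_le H f hf) ?_
  rw [Subgroup.card_eq_card_quotient_mul_card_subgroup H]
  refine Nat.mul_le_mul_right _ ?_
  -- a choice of coset representatives embeds the quotient into the range
  rw [← Nat.card_coe_set_eq]
  refine Nat.card_le_card_of_injective
    (fun q : G ⧸ H => (⟨f q.out⁻¹, _, rfl⟩ : Set.range f)) fun q q' h => ?_
  have := hinj _ _ (congrArg Subtype.val h)
  rw [inv_inv] at this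
  rw [← QuotientGroup.out_eq' q, ← QuotientGroup.out_eq' q', QuotientGroup.eq]
  exact this

end Cosets

/-! ### The symmetry group of the cycle -/

namespace CyclicBD

section Dihedral

variable {m : ℕ} [NeZero m]

lemma toZMod_finRotate (i : Fin m) : toZMod m (finRotate m i) = toZMod m i + 1 := by
  obtain ⟨n, rfl⟩ := Nat.exists_eq_succ_of_ne_zero (NeZero.ne m)
  simp only [toZMod_apply]
  rcases eq_or_ne i (Fin.last n) with rfl | hi
  · rw [finRotate_last]
    simp
  · rw [coe_finRotate_of_ne_last hi]
    push_cast
    rfl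

lemma toZMod_rev (i : Fin m) : toZMod m (Fin.revPerm i) = -toZMod m i - 1 := by
  simp only [toZMod_apply, Fin.revPerm_apply, Fin.val_rev]
  rw [Nat.cast_sub (Nat.succ_le_of_lt i.2), ZMod.natCast_self]
  push_cast
  ring

/-- The permutation of `{0, …, m - 1}` that reads `x ↦ ε x + c` modulo `m`. -/
def affinePerm (ε : ℤˣ) (c : ZMod m) : Equiv.Perm (Fin m) where
  toFun i := (toZMod m).symm (((ε : ℤ) : ZMod m) * toZMod m i + c)
  invFun i := (toZMod m).symm (((ε : ℤ) : ZMod m) * (toZMod m i - c))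
  left_inv i := by
    have h : ((ε : ℤ) : ZMod m) * ((ε : ℤ) : ZMod m) = 1 := by
      rw [← Int.cast_mul, ← Units.val_mul, Int.units_mul_self]; simp
    dsimp only
    rw [Equiv.apply_symm_apply, Equiv.symm_apply_eq]
    linear_combination toZMod m i * h
  right_inv i := by
    have h : ((ε : ℤ) : ZMod m) * ((ε : ℤ) : ZMod m) = 1 := by
      rw [← Int.cast_mul, ← Units.val_mul, Int.units_mul_self]; simp
    dsimp only
    rw [Equiv.apply_symm_apply, Equiv.symm_apply_eq]
    linear_combination (toZMod m i - c) * h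

lemma toZMod_affinePerm (ε : ℤˣ) (c : ZMod m) (i : Fin m) :
    toZMod m (affinePerm ε c i) = ((ε : ℤ) : ZMod m) * toZMod m i + c :=
  Equiv.apply_symm_apply _ _

lemma eq_affinePerm_iff (σ : Equiv.Perm (Fin m)) (ε : ℤˣ) (c : ZMod m) :
    σ = affinePerm ε c ↔ ∀ i, toZMod m (σ i) = ((ε : ℤ) : ZMod m) * toZMod m i + c := by
  constructor
  · rintro rfl i
    exact toZMod_affinePerm ε c i
  · intro h
    ext1 i
    exact (toZMod m).injective ((h i).trans (toZMod_affinePerm ε c i).symm)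

lemma affinePerm_mul (ε δ : ℤˣ) (c d : ZMod m) :
    affinePerm ε c * affinePerm δ d = affinePerm (ε * δ) (((ε : ℤ) : ZMod m) * d + c) := by
  rw [eq_affinePerm_iff]
  intro i
  rw [Equiv.Perm.mul_apply, toZMod_affinePerm, toZMod_affinePerm]
  push_cast
  ring

lemma affinePerm_inv (ε : ℤˣ) (c : ZMod m) :
    (affinePerm ε c)⁻¹ = affinePerm ε (-(((ε : ℤ) : ZMod m) * c)) := by
  rw [inv_eq_iff_mul_eq_one, affinePerm_mul, Int.units_mul_self, eq_comm, eq_affinePerm_iff]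
  have h : ((ε : ℤ) : ZMod m) * ((ε : ℤ) : ZMod m) = 1 := by
    rw [← Int.cast_mul, ← Units.val_mul, Int.units_mul_self]; simp
  intro i
  simp only [Equiv.Perm.coe_one, id_eq, Units.val_one, Int.cast_one]
  linear_combination c * h

lemma finRotate_eq_affinePerm : finRotate m = affinePerm 1 1 := by
  rw [eq_affinePerm_iff]
  intro i
  simp only [toZMod_finRotate, Units.val_one, Int.cast_one, one_mul]

lemma revPerm_eq_affinePerm : (Fin.revPerm : Equiv.Perm (Fin m)) = affinePerm (-1) (-1) := by
  rw [eq_affinePerm_iff]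
  intro i
  rw [toZMod_rev]
  simp
  ring

lemma affinePerm_one_natCast (n : ℕ) : affinePerm 1 (n : ZMod m) = finRotate m ^ n := by
  induction n with
  | zero =>
    rw [pow_zero, eq_comm, eq_affinePerm_iff]
    simp
  | succ n ih =>
    rw [pow_succ, ← ih, finRotate_eq_affinePerm, affinePerm_mul]
    congr 1
    push_cast
    ring

lemma mem_rotationsAndReversals_iff (σ : Equiv.Perm (Fin m)) :
    σ ∈ rotationsAndReversals m ↔ ∃ (ε : ℤˣ) (c : ZMod m), σ = affinePerm ε c := by
  constructor
  · intro h
    induction h using Subgroup.closure_induction with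
    | mem x hx =>
      rcases hx with rfl | rfl
      · exact ⟨1, 1, finRotate_eq_affinePerm⟩
      · exact ⟨-1, -1, revPerm_eq_affinePerm⟩
    | one => exact ⟨1, 0, by rw [eq_affinePerm_iff]; simp⟩
    | mul x y _ _ hx hy =>
      obtain ⟨ε, c, rfl⟩ := hx
      obtain ⟨δ, d, rfl⟩ := hy
      exact ⟨_, _, affinePerm_mul ..⟩
    | inv x _ hx =>
      obtain ⟨ε, c, rfl⟩ := hx
      exact ⟨_, _, affinePerm_inv ..⟩
  · rintro ⟨ε, c, rfl⟩
    have hrot : ∀ c : ZMod m, affinePerm 1 c ∈ rotationsAndReversals m := by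
      intro c
      rw [← ZMod.natCast_zmod_val c, affinePerm_one_natCast]
      exact pow_mem (Subgroup.subset_closure (by simp)) _
    rcases Int.units_eq_one_or ε with rfl | rfl
    · exact hrot c
    · have : affinePerm (-1) c = affinePerm 1 (c + 1) * Fin.revPerm := by
        rw [revPerm_eq_affinePerm, affinePerm_mul]
        simp
      rw [this]
      exact mul_mem (hrot _) (Subgroup.subset_closure (by simp))

lemma affinePerm_injective (hm : 3 ≤ m) :
    Function.Injective fun x : ℤˣ × ZMod m => affinePerm x.1 x.2 := by
  rintro ⟨ε, c⟩ ⟨δ, d⟩ h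
  have h' := (eq_affinePerm_iff _ _ _).1 h
  simp only [toZMod_affinePerm] at h'
  have h0 := h' ((toZMod m).symm 0)
  have h1 := h' ((toZMod m).symm 1)
  simp only [Equiv.apply_symm_apply, mul_zero, zero_add, mul_one] at h0 h1
  have h2 : (2 : ZMod m) ≠ 0 := by
    intro h
    have h' : ((2 : ℕ) : ZMod m) = 0 := by exact_mod_cast h
    have := Nat.le_of_dvd (by norm_num) ((ZMod.natCast_eq_zero_iff 2 m).1 h')
    omega
  have h3 : ε = δ := by
    rcases Int.units_eq_one_or ε with rfl | rfl <;> rcases Int.units_eq_one_or δ with rfl | rfl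
    · rfl
    · simp only [Units.val_one, Int.cast_one, Units.val_neg, Int.cast_neg] at h1
      exact absurd (by linear_combination h1 - h0) h2
    · simp only [Units.val_one, Int.cast_one, Units.val_neg, Int.cast_neg] at h1
      exact absurd (by linear_combination h0 - h1) h2
    · rfl
  rw [h3, h0]

lemma card_rotationsAndReversals (hm : 3 ≤ m) : Nat.card (rotationsAndReversals m) = 2 * m := by
  have h : ((rotationsAndReversals m : Subgroup _) : Set (Equiv.Perm (Fin m))) =
      Set.range fun x : ℤˣ × ZMod m => affinePerm x.1 x.2 := by
    ext σ
    simp [mem_rotationsAndReversals_iff, eq_comm]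
  have h' : Nat.card (rotationsAndReversals m) =
      Nat.card (Set.range fun x : ℤˣ × ZMod m => affinePerm x.1 x.2) := by
    rw [← h]; rfl
  rw [h', Nat.card_range_of_injective (affinePerm_injective hm), Nat.card_prod,
    Nat.card_eq_fintype_card, Nat.card_eq_fintype_card, ZMod.card]
  simp

end Dihedral

end CyclicBD

/-! ### Fourth-moment law of large numbers for the chain -/

namespace CyclicBD

section LargeNumbers

variable {m : ℕ} [NeZero m] (p : Fin m → Set.Ioo (0 : ℝ) 1) (x : ℤ)

instance : IsProbabilityMeasure (chainLaw p x) := by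
  unfold chainLaw; infer_instance

lemma lintegral_chainLaw_zero (f : ℤ → ENNReal) :
    ∫⁻ X, f (X 0) ∂(chainLaw p x) = f x := by
  have hf : Measurable fun X : ℕ → ℤ => f (X 0) :=
    (measurable_of_countable f).comp (measurable_pi_apply 0)
  rw [chainLaw, Kernel.trajMeasure, Measure.lintegral_bind (Kernel.aemeasurable _) hf.aemeasurable,
    lintegral_map hf.lintegral_kernel (MeasurableEquiv.measurable _), lintegral_dirac,
    Kernel.lintegral_traj _ hf]
  simp [Function.updateFinset]

/-- The Markov property: conditioning on `X n` expresses an expectation of a function of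
`(X n, X (n + 1))` through the two possible steps. -/
lemma lintegral_chainLaw_succ (F : ℤ → ℤ → ENNReal) (n : ℕ) :
    ∫⁻ X, F (X n) (X (n + 1)) ∂(chainLaw p x) =
      ∫⁻ X, (ENNReal.ofReal (p (residue m (X n))) * F (X n) (X n + 1) +
        ENNReal.ofReal (1 - p (residue m (X n))) * F (X n) (X n - 1)) ∂(chainLaw p x) := by
  set G : (Finset.Iic n → ℤ) × ℤ → ENNReal :=
    fun z => F (z.1 ⟨n, Finset.mem_Iic.2 le_rfl⟩) z.2 with hG
  have hGm : Measurable G := measurable_of_countable G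
  have hmap := Kernel.map_frestrictLe_trajMeasure_compProd_eq_map_trajMeasure
    (X := fun _ => ℤ) (μ₀ := Measure.dirac x) (κ := historyKernel p) (a := n)
  have hpair : Measurable fun X : ℕ → ℤ => (Preorder.frestrictLe (π := fun _ => ℤ) n X, X (n + 1)) :=
    (Preorder.measurable_frestrictLe n).prodMk (measurable_pi_apply _)
  have h1 : ∫⁻ X, F (X n) (X (n + 1)) ∂(chainLaw p x) =
      ∫⁻ z, G z ∂((chainLaw p x).map
        fun X => (Preorder.frestrictLe (π := fun _ => ℤ) n X, X (n + 1))) := by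
    rw [lintegral_map hGm hpair]
    rfl
  rw [h1, chainLaw, ← hmap, Measure.lintegral_compProd hGm,
    lintegral_map (hGm.lintegral_kernel_prod_right') (Preorder.measurable_frestrictLe n)]
  refine lintegral_congr fun X => ?_
  have hk : historyKernel p n (Preorder.frestrictLe (π := fun _ => ℤ) n X) =
      stepLaw p (X n) := rfl
  rw [hk, stepLaw, lintegral_add_measure, lintegral_smul_measure, lintegral_smul_measure,
    lintegral_dirac, lintegral_dirac]
  rfl

/-- Second moment of a centred two-point perturbation. -/
lemma two_point_sq_le {a b d e K M : ℝ} (ha : 0 ≤ a) (hb : 0 ≤ b) (hab : a + b = 1)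
    (h0 : a * d + b * e = 0) (hd : |d| ≤ K) (he : |e| ≤ K) :
    a * (M + d) ^ 2 + b * (M + e) ^ 2 ≤ M ^ 2 + K ^ 2 := by
  have hd2 : d ^ 2 ≤ K ^ 2 := sq_le_sq' (abs_le.1 hd).1 (abs_le.1 hd).2
  have he2 : e ^ 2 ≤ K ^ 2 := sq_le_sq' (abs_le.1 he).1 (abs_le.1 he).2
  have h1 := mul_le_mul_of_nonneg_left hd2 ha
  have h2 := mul_le_mul_of_nonneg_left he2 hb
  have h3 : a * (M + d) ^ 2 + b * (M + e) ^ 2 =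
      (a + b) * M ^ 2 + 2 * M * (a * d + b * e) + (a * d ^ 2 + b * e ^ 2) := by ring
  rw [h3, hab, h0]
  have h4 : a * K ^ 2 + b * K ^ 2 = K ^ 2 := by rw [← add_mul, hab, one_mul]
  linarith

/-- Fourth moment of a centred two-point perturbation: the term linear in the perturbation
vanishes, and the cubic one is absorbed by `4 M d³ ≤ 2 M² d² + 2 d⁴`. -/
lemma two_point_pow_four_le {a b d e K M : ℝ} (ha : 0 ≤ a) (hb : 0 ≤ b) (hab : a + b = 1)
    (h0 : a * d + b * e = 0) (hd : |d| ≤ K) (he : |e| ≤ K) :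
    a * (M + d) ^ 4 + b * (M + e) ^ 4 ≤ M ^ 4 + 8 * K ^ 2 * M ^ 2 + 3 * K ^ 4 := by
  have aux : ∀ t : ℝ, |t| ≤ K →
      (M + t) ^ 4 ≤ M ^ 4 + 4 * M ^ 3 * t + 8 * K ^ 2 * M ^ 2 + 3 * K ^ 4 := by
    intro t ht
    have ht2 : t ^ 2 ≤ K ^ 2 := sq_le_sq' (abs_le.1 ht).1 (abs_le.1 ht).2
    have ht4 : t ^ 4 ≤ K ^ 4 := by
      calc t ^ 4 = (t ^ 2) ^ 2 := by ring
        _ ≤ (K ^ 2) ^ 2 := pow_le_pow_left₀ (sq_nonneg t) ht2 2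
        _ = K ^ 4 := by ring
    have h1 := mul_le_mul_of_nonneg_right ht2 (sq_nonneg M)
    nlinarith [sq_nonneg (M * t - t ^ 2)]
  have h1 := mul_le_mul_of_nonneg_left (aux d hd) ha
  have h2 := mul_le_mul_of_nonneg_left (aux e he) hb
  have h3 : a * (M ^ 4 + 4 * M ^ 3 * d + 8 * K ^ 2 * M ^ 2 + 3 * K ^ 4) +
      b * (M ^ 4 + 4 * M ^ 3 * e + 8 * K ^ 2 * M ^ 2 + 3 * K ^ 4) =
      (a + b) * (M ^ 4 + 8 * K ^ 2 * M ^ 2 + 3 * K ^ 4) + 4 * M ^ 3 * (a * d + b * e) := by ring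
  rw [hab, h0] at h3
  linarith

/-- A pointwise bound on the one-step transition operator integrates along the chain. The
expectations are `lintegral`s, so no integrability has to be known beforehand. -/
lemma lintegral_chainLaw_succ_le {f g : ℤ → ℝ} (hf : ∀ z, 0 ≤ f z)
    (h : ∀ z, p (residue m z) * f (z + 1) + (1 - p (residue m z)) * f (z - 1) ≤ g z) (n : ℕ) :
    ∫⁻ X, ENNReal.ofReal (f (X (n + 1))) ∂(chainLaw p x) ≤
      ∫⁻ X, ENNReal.ofReal (g (X n)) ∂(chainLaw p x) := by
  rw [lintegral_chainLaw_succ p x (fun _ y => ENNReal.ofReal (f y)) n]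
  refine lintegral_mono fun X => ?_
  have hp := (p (residue m (X n))).2
  have hq : 0 ≤ 1 - (p (residue m (X n)) : ℝ) := by linarith [hp.2]
  rw [← ENNReal.ofReal_mul hp.1.le, ← ENNReal.ofReal_mul hq,
    ← ENNReal.ofReal_add (mul_nonneg hp.1.le (hf _)) (mul_nonneg hq (hf _))]
  exact ENNReal.ofReal_le_ofReal (h _)

section Martingale

variable {p} {u : ℤ → ℝ} {v K : ℝ}
  (hu : ∀ z, p (residue m z) * (u (z + 1) - u z - v) +
    (1 - p (residue m z)) * (u (z - 1) - u z - v) = 0)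
  (hK1 : ∀ z, |u (z + 1) - u z - v| ≤ K) (hK2 : ∀ z, |u (z - 1) - u z - v| ≤ K)

include hu hK1 hK2

lemma lintegral_sq_le (n : ℕ) :
    ∫⁻ X, ENNReal.ofReal ((u (X n) - u x - n * v) ^ 2) ∂(chainLaw p x) ≤
      ENNReal.ofReal (n * K ^ 2) := by
  induction n with
  | zero =>
    rw [lintegral_chainLaw_zero p x (fun z => ENNReal.ofReal ((u z - u x - (0 : ℕ) * v) ^ 2))]
    simp
  | succ n ih =>
    refine (lintegral_chainLaw_succ_le p x
      (f := fun z => (u z - u x - (n + 1 : ℕ) * v) ^ 2)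
      (g := fun z => (u z - u x - n * v) ^ 2 + K ^ 2) (fun z => sq_nonneg _) (fun z => ?_) n).trans ?_
    · have hp := (p (residue m z)).2
      have := two_point_sq_le (M := u z - u x - n * v) hp.1.le (by linarith [hp.2])
        (add_sub_cancel _ _) (hu z) (hK1 z) (hK2 z)
      convert this using 4 <;> push_cast <;> ring
    · have hK : (0 : ℝ) ≤ n * K ^ 2 := by positivity
      simp_rw [fun z => ENNReal.ofReal_add (sq_nonneg (u z - u x - n * v)) (sq_nonneg K)]
      rw [lintegral_add_right _ measurable_const, lintegral_const, measure_univ, mul_one]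
      refine (add_le_add_left ih _).trans ?_
      rw [← ENNReal.ofReal_add hK (sq_nonneg K)]
      exact ENNReal.ofReal_le_ofReal (by push_cast; linarith)

lemma lintegral_pow_four_le (n : ℕ) :
    ∫⁻ X, ENNReal.ofReal ((u (X n) - u x - n * v) ^ 4) ∂(chainLaw p x) ≤
      ENNReal.ofReal (8 * K ^ 4 * n ^ 2) := by
  induction n with
  | zero =>
    rw [lintegral_chainLaw_zero p x (fun z => ENNReal.ofReal ((u z - u x - (0 : ℕ) * v) ^ 4))]
    simp
  | succ n ih =>
    refine (lintegral_chainLaw_succ_le p x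
      (f := fun z => (u z - u x - (n + 1 : ℕ) * v) ^ 4)
      (g := fun z => (u z - u x - n * v) ^ 4 + 8 * K ^ 2 * (u z - u x - n * v) ^ 2 + 3 * K ^ 4)
      (fun z => by positivity) (fun z => ?_) n).trans ?_
    · have hp := (p (residue m z)).2
      have := two_point_pow_four_le (M := u z - u x - n * v) hp.1.le (by linarith [hp.2])
        (add_sub_cancel _ _) (hu z) (hK1 z) (hK2 z)
      convert this using 4 <;> push_cast <;> ring
    · have hm : ∀ k : ℕ, Measurable fun X : ℕ → ℤ => ENNReal.ofReal ((u (X n) - u x - n * v) ^ k) :=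
        fun k => (measurable_of_countable
          (fun z : ℤ => ENNReal.ofReal ((u z - u x - n * v) ^ k))).comp (measurable_pi_apply n)
      have h4 : ∀ z : ℤ, ENNReal.ofReal ((u z - u x - n * v) ^ 4 +
          8 * K ^ 2 * (u z - u x - n * v) ^ 2 + 3 * K ^ 4) =
          ENNReal.ofReal ((u z - u x - n * v) ^ 4) +
          ENNReal.ofReal (8 * K ^ 2) * ENNReal.ofReal ((u z - u x - n * v) ^ 2) +
          ENNReal.ofReal (3 * K ^ 4) := fun z => by
        rw [ENNReal.ofReal_add (by positivity) (by positivity),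
          ENNReal.ofReal_add (by positivity) (by positivity), ENNReal.ofReal_mul (by positivity)]
      simp_rw [h4]
      rw [lintegral_add_right _ measurable_const, lintegral_const, measure_univ, mul_one,
        lintegral_add_left (hm 4), lintegral_const_mul _ (hm 2)]
      refine (add_le_add_left (add_le_add ih
        (mul_le_mul_right (lintegral_sq_le x hu hK1 hK2 n) _)) _).trans ?_
      rw [← ENNReal.ofReal_mul (by positivity), ← ENNReal.ofReal_add (by positivity) (by positivity),
        ← ENNReal.ofReal_add (by positivity) (by positivity)]
      refine ENNReal.ofReal_le_ofReal ?_
      push_cast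
      have : 0 ≤ K ^ 4 := by positivity
      have hn : (0 : ℝ) ≤ n := n.cast_nonneg
      nlinarith [mul_nonneg this hn]

/-- The martingale `u (X n) - n v` is `o(n)` almost surely: its normalised fourth moments are
summable. -/
lemma ae_tendsto_martingale_div :
    ∀ᵐ X ∂(chainLaw p x),
      Tendsto (fun n : ℕ => (u (X n) - u x - n * v) / n) atTop (𝓝 0) := by
  have hm : ∀ n : ℕ, Measurable fun X : ℕ → ℤ =>
      ENNReal.ofReal (((u (X n) - u x - n * v) / n) ^ 4) := fun n =>
    (measurable_of_countable (fun z : ℤ => ENNReal.ofReal (((u z - u x - n * v) / n) ^ 4))).comp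
      (measurable_pi_apply n)
  have hbound : ∀ n : ℕ, ∫⁻ X, ENNReal.ofReal (((u (X n) - u x - n * v) / n) ^ 4) ∂(chainLaw p x) ≤
      ENNReal.ofReal (8 * K ^ 4 * (1 / (n : ℝ) ^ 2)) := by
    intro n
    rcases Nat.eq_zero_or_pos n with rfl | hn
    · simp
    have hn' : (0 : ℝ) < n := by exact_mod_cast hn
    have hc : (0 : ℝ) ≤ 1 / (n : ℝ) ^ 4 := by positivity
    have he : ∀ X : ℕ → ℤ, ENNReal.ofReal (((u (X n) - u x - n * v) / n) ^ 4) =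
        ENNReal.ofReal (1 / (n : ℝ) ^ 4) * ENNReal.ofReal ((u (X n) - u x - n * v) ^ 4) := fun X => by
      rw [← ENNReal.ofReal_mul hc, div_pow]
      congr 1
      ring
    simp_rw [he]
    rw [lintegral_const_mul' _ _ ENNReal.ofReal_ne_top]
    refine (mul_le_mul_right (lintegral_pow_four_le x hu hK1 hK2 n) _).trans ?_
    rw [← ENNReal.ofReal_mul hc]
    refine ENNReal.ofReal_le_ofReal (le_of_eq ?_)
    field_simp
  have hsum : ∑' n : ℕ, ENNReal.ofReal (8 * K ^ 4 * (1 / (n : ℝ) ^ 2)) ≠ ⊤ :=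
    (Summable.mul_left _ (Real.summable_one_div_nat_pow.2 one_lt_two)).tsum_ofReal_ne_top
  have hint : ∫⁻ X, ∑' n : ℕ, ENNReal.ofReal (((u (X n) - u x - n * v) / n) ^ 4)
      ∂(chainLaw p x) ≠ ⊤ := by
    rw [lintegral_tsum fun n => (hm n).aemeasurable]
    exact ne_top_of_le_ne_top hsum (ENNReal.tsum_le_tsum hbound)
  filter_upwards [ae_lt_top (Measurable.tsum hm) hint] with X hX
  have h1 := ENNReal.tendsto_atTop_zero_of_tsum_ne_top hX.ne
  have h2 : Tendsto (fun n : ℕ => ((u (X n) - u x - n * v) / n) ^ 4) atTop (𝓝 0) := by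
    have := (ENNReal.tendsto_toReal ENNReal.zero_ne_top).comp h1
    refine this.congr fun n => ?_
    simp only [Function.comp_apply]
    exact ENNReal.toReal_ofReal (by positivity)
  rw [tendsto_zero_iff_abs_tendsto_zero]
  have h3 := (h2.sqrt).sqrt
  simp only [Real.sqrt_zero] at h3
  refine h3.congr fun n => ?_
  simp only [Function.comp_apply]
  rw [show ∀ t : ℝ, t ^ 4 = (t ^ 2) ^ 2 from fun t => by ring, Real.sqrt_sq (sq_nonneg _),
    Real.sqrt_sq_eq_abs]

end Martingale

/-- If a bounded perturbation `u` of the identity solves the Poisson equation `P u - u = v`,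
then the chain has speed `v`. -/
theorem hasSpeed_of_poisson {p : Fin m → Set.Ioo (0 : ℝ) 1} {u : ℤ → ℝ} {v C : ℝ}
    (hC : ∀ z : ℤ, |u z - z| ≤ C)
    (hu : ∀ z, p (residue m z) * (u (z + 1) - u z) +
      (1 - p (residue m z)) * (u (z - 1) - u z) = v) : HasSpeed p v := by
  intro x
  have hK1 : ∀ z, |u (z + 1) - u z - v| ≤ 2 * C + 1 + |v| := fun z => by
    have h1 := hC z
    have h2 := hC (z + 1)
    push_cast at h2
    rw [abs_le] at *
    have := neg_abs_le v
    have := le_abs_self v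
    constructor <;> linarith [h1.1, h1.2, h2.1, h2.2]
  have hK2 : ∀ z, |u (z - 1) - u z - v| ≤ 2 * C + 1 + |v| := fun z => by
    have h1 := hC z
    have h2 := hC (z - 1)
    push_cast at h2
    rw [abs_le] at *
    have := neg_abs_le v
    have := le_abs_self v
    constructor <;> linarith [h1.1, h1.2, h2.1, h2.2]
  filter_upwards [ae_tendsto_martingale_div x (v := v)
    (fun z => by linear_combination hu z) hK1 hK2] with X hX
  have hb : Tendsto (fun n : ℕ => ((X n : ℝ) - u (X n) + u x) / n) atTop (𝓝 0) := by
    refine squeeze_zero_norm (a := fun n : ℕ => (C + |u x|) / (n : ℝ)) (fun n => ?_)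
      (tendsto_const_div_atTop_nhds_zero_nat _)
    rw [norm_div, Real.norm_natCast, Real.norm_eq_abs]
    refine div_le_div_of_nonneg_right ?_ n.cast_nonneg
    refine (abs_add_le _ _).trans (add_le_add_left ?_ _)
    rw [abs_sub_comm]
    exact hC _
  have := (hX.add hb).add_const v
  rw [zero_add, zero_add] at this
  refine this.congr' ?_
  filter_upwards [eventually_ne_atTop 0] with n hn
  have hn' : (n : ℝ) ≠ 0 := by exact_mod_cast hn
  field_simp
  ring

lemma HasSpeed.unique {p : Fin m → Set.Ioo (0 : ℝ) 1} {v w : ℝ} (hv : HasSpeed p v)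
    (hw : HasSpeed p w) : v = w := by
  obtain ⟨X, h1, h2⟩ := ((hv 0).and (hw 0)).exists
  exact tendsto_nhds_unique h1 h2

lemma HasSpeed.speed_eq {p : Fin m → Set.Ioo (0 : ℝ) 1} {v : ℝ} (hv : HasSpeed p v) :
    speed p = v := by
  have h : ∃ v, HasSpeed p v := ⟨v, hv⟩
  rw [speed, dif_pos h]
  exact h.choose_spec.unique hv

end LargeNumbers

end CyclicBD

/-! ### The speed formula -/

namespace CyclicBD

section Speed

variable {m : ℕ} [NeZero m]

/-- The birth probabilities as a real function on `ℤ / m`. -/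
def birth (p : Fin m → Set.Ioo (0 : ℝ) 1) (z : ZMod m) : ℝ := p ((toZMod m).symm z)

/-- A function on `ℤ / m` with zero sum is the discrete derivative of a periodic function. -/
lemma exists_sub_eq_of_sum_eq_zero (hm : 3 ≤ m) {d : ZMod m → ℝ} (hd : ∑ z, d z = 0) :
    ∃ h : ZMod m → ℝ, ∀ z, h (z + 1) - h z = d z := by
  have : Fact (1 < m) := ⟨by omega⟩
  refine ⟨fun z => ∑ j ∈ Finset.range z.val, d (j : ZMod m), fun z => ?_⟩
  have hz := ZMod.val_lt z
  rcases Nat.lt_or_ge (z.val + 1) m with hlt | hge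
  · have hv : (z + 1).val = z.val + 1 := by
      rw [ZMod.val_add_of_lt (by rwa [ZMod.val_one]), ZMod.val_one]
    simp only [hv, Finset.sum_range_succ, ZMod.natCast_zmod_val]
    ring
  · -- wrap-around from `m - 1` to `0`
    have hzm : z.val + 1 = m := by omega
    have hv : z + 1 = 0 := by
      rw [← ZMod.natCast_zmod_val z, ← Nat.cast_one (R := ZMod m), ← Nat.cast_add, hzm,
        ZMod.natCast_self]
    rw [← sum_range_natCast d, congrArg Finset.range hzm.symm,
      Finset.sum_range_succ, ZMod.natCast_zmod_val] at hd
    simp only [hv, ZMod.val_zero, Finset.range_zero, Finset.sum_empty]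
    linarith

lemma totalWeight_birth_pos (p : Fin m → Set.Ioo (0 : ℝ) 1) : 0 < totalWeight (birth p) :=
  Finset.sum_pos (fun i _ => weight_pos (fun _ => (p _).2.1) (fun _ => (p _).2.2) i)
    Finset.univ_nonempty

/-- The weights, normalised to have sum `m`, are the increments of a solution of the Poisson
equation that stays at bounded distance from the identity. -/
theorem hasSpeed_formula (hm : 3 ≤ m) (p : Fin m → Set.Ioo (0 : ℝ) 1) :
    HasSpeed p (m * (∏ i, (p i : ℝ) - ∏ i, (1 - (p i : ℝ))) / totalWeight (birth p)) := by
  set W := totalWeight (birth p) with hW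
  have hWpos : 0 < W := totalWeight_birth_pos p
  obtain ⟨h, hh⟩ := exists_sub_eq_of_sum_eq_zero hm
    (d := fun z => m * weight (birth p) z / W - 1) (by
      rw [Finset.sum_sub_distrib, ← Finset.sum_div, ← Finset.mul_sum]
      change m * W / W - _ = 0
      simp [hWpos.ne', ZMod.card])
  obtain ⟨C, hC⟩ : ∃ C, ∀ z, |h z| ≤ C := by
    obtain ⟨C, hC⟩ := (Set.finite_range fun z => |h z|).bddAbove
    exact ⟨C, fun z => hC ⟨z, rfl⟩⟩
  refine hasSpeed_of_poisson (u := fun z : ℤ => z + h (z : ZMod m)) (C := C)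
    (fun z => by simpa using hC (z : ZMod m)) fun z => ?_
  have h1 := hh (z : ZMod m)
  have h2 := hh ((z : ZMod m) - 1)
  rw [sub_add_cancel] at h2
  have hr := weight_recursion (birth p) (z : ZMod m)
  have hA : ∏ w, birth p w = ∏ i, (p i : ℝ) :=
    Equiv.prod_comp (toZMod m).symm fun i => (p i : ℝ)
  have hB : ∏ w, (1 - birth p w) = ∏ i, (1 - (p i : ℝ)) :=
    Equiv.prod_comp (toZMod m).symm fun i => 1 - (p i : ℝ)
  have hb : (p (residue m z) : ℝ) = birth p z := by rw [residue_eq_toZMod_symm]; rfl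
  rw [hA, hB] at hr
  rw [hb, ← hr]
  push_cast
  have e1 : h ((z : ZMod m) + 1) = h z + (m * weight (birth p) z / W - 1) := by linarith
  have e2 : h ((z : ZMod m) - 1) = h z - (m * weight (birth p) (z - 1) / W - 1) := by linarith
  rw [e1, e2]
  field_simp
  ring

lemma speed_formula (hm : 3 ≤ m) (p : Fin m → Set.Ioo (0 : ℝ) 1) :
    speed p = m * (∏ i, (p i : ℝ) - ∏ i, (1 - (p i : ℝ))) / totalWeight (birth p) :=
  (hasSpeed_formula hm p).speed_eq

lemma speed_reorder (hm : 3 ≤ m) (p : Fin m → Set.Ioo (0 : ℝ) 1) (σ : Equiv.Perm (Fin m)) :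
    speed (reorder σ p) = m * (∏ i, (p i : ℝ) - ∏ i, (1 - (p i : ℝ))) /
      totalWeight (birth (reorder σ p)) := by
  rw [speed_formula hm]
  simp only [reorder]
  rw [Equiv.prod_comp σ⁻¹ fun i => (p i : ℝ), Equiv.prod_comp σ⁻¹ fun i => 1 - (p i : ℝ)]

omit [NeZero m] in
lemma reorder_mul (σ τ : Equiv.Perm (Fin m)) (p : Fin m → Set.Ioo (0 : ℝ) 1) :
    reorder (σ * τ) p = reorder σ (reorder τ p) := by
  ext i
  simp [reorder, mul_inv_rev]

lemma speed_reorder_of_mem (hm : 3 ≤ m) {σ : Equiv.Perm (Fin m)}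
    (hσ : σ ∈ rotationsAndReversals m) (p : Fin m → Set.Ioo (0 : ℝ) 1) :
    speed (reorder σ p) = speed p := by
  obtain ⟨ε, c, hs⟩ := (mem_rotationsAndReversals_iff _).1 (inv_mem hσ)
  have hb : birth (reorder σ p) = fun z => birth p (((ε : ℤ) : ZMod m) * z + c) := by
    ext z
    simp only [birth, reorder, hs]
    rw [← (Equiv.symm_apply_eq _).2 (toZMod_affinePerm ε c _).symm, Equiv.apply_symm_apply]
  rw [speed_reorder hm, speed_formula hm, hb]
  congr 1
  rcases Int.units_eq_one_or ε with rfl | rfl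
  · simpa using totalWeight_comp_add (birth p) c
  · rw [← totalWeight_comp_add (birth p) c, ← totalWeight_comp_neg fun z => birth p (z + c)]
    simp

lemma numSpeeds_mul_le (hm : 3 ≤ m) (p : Fin m → Set.Ioo (0 : ℝ) 1) :
    numSpeeds p * (2 * m) ≤ m ! := by
  have := ncard_range_mul_card_le (rotationsAndReversals m) (fun σ => speed (reorder σ p))
    fun h hh g => by rw [reorder_mul, speed_reorder_of_mem hm hh]
  rwa [card_rotationsAndReversals hm, Nat.card_perm, Nat.card_fin] at this

end Speed

/-! ### Generic parameters -/

section Generic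

variable {m : ℕ} [NeZero m]

/-- For a vector of reals in general position, `∏ p ≠ ∏ (1 - p)` and the total weights of two
reorderings agree only if the reorderings differ by a symmetry of the cycle. -/
lemma ae_generic (hm : 3 ≤ m) : ∀ᵐ x : Fin m → ℝ,
    (∏ i, x i - ∏ i, (1 - x i) ≠ 0) ∧
    ∀ σ τ : Equiv.Perm (Fin m), σ * τ⁻¹ ∉ rotationsAndReversals m →
      totalWeight (fun z => x (σ⁻¹ ((toZMod m).symm z))) ≠
        totalWeight (fun z => x (τ⁻¹ ((toZMod m).symm z))) := by
  have h1 : ∀ᵐ x : Fin m → ℝ, ∏ i, x i - ∏ i, (1 - x i) ≠ 0 := by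
    set P : MvPolynomial (Fin m) ℝ :=
      ∏ i, MvPolynomial.X i - ∏ i, (1 - MvPolynomial.X i) with hP
    have hev : ∀ x : Fin m → ℝ, MvPolynomial.eval x P = ∏ i, x i - ∏ i, (1 - x i) := fun x => by
      simp [hP, map_prod]
    have hP0 : P ≠ 0 := by
      intro h
      have := hev 1
      simp [h, NeZero.ne m] at this
    filter_upwards [MvPolynomial.ae_eval_ne_zero hP0] with x hx
    rwa [hev] at hx
  refine h1.and ?_
  rw [ae_all_iff]
  intro σ
  rw [ae_all_iff]
  intro τ
  by_cases hστ : σ * τ⁻¹ ∈ rotationsAndReversals m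
  · exact Eventually.of_forall fun _ h => absurd hστ h
  set P : MvPolynomial (Fin m) ℝ :=
    totalWeight (fun z => MvPolynomial.X (σ⁻¹ ((toZMod m).symm z))) -
      totalWeight (fun z => MvPolynomial.X (τ⁻¹ ((toZMod m).symm z))) with hP
  have hev : ∀ x : Fin m → ℝ, MvPolynomial.eval x P =
      totalWeight (fun z => x (σ⁻¹ ((toZMod m).symm z))) -
        totalWeight (fun z => x (τ⁻¹ ((toZMod m).symm z))) := fun x => by
    simp [hP, map_totalWeight]
  have hP0 : P ≠ 0 := by
    intro h0
    refine hστ ?_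
    -- vanishing of the polynomial makes the conjugate of `τ * σ⁻¹` preserve the total weight
    set π : Equiv.Perm (ZMod m) := ((toZMod m).symm.trans (τ * σ⁻¹)).trans (toZMod m) with hπ
    obtain ⟨ε, c, hc⟩ := exists_affine_of_totalWeight_comp hm π fun a => by
      have := hev fun i => a (toZMod m (τ i))
      rw [h0, map_zero, eq_comm, sub_eq_zero] at this
      simpa [hπ] using this
    have hmem : τ * σ⁻¹ ∈ rotationsAndReversals m := by
      refine (mem_rotationsAndReversals_iff _).2 ⟨ε, c, (eq_affinePerm_iff _ _ _).2 fun i => ?_⟩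
      simpa [hπ] using hc (toZMod m i)
    simpa using inv_mem hmem
  filter_upwards [MvPolynomial.ae_eval_ne_zero hP0] with x hx _
  rw [hev] at hx
  exact sub_ne_zero.1 hx

end Generic

end CyclicBD

theorem theorem1p2 (m : ℕ) [NeZero m] (hm : 3 ≤ m) :
    (∀ p : Fin m → Set.Ioo (0 : ℝ) 1,
      CyclicBD.HasSpeed p (CyclicBD.speed p) ∧
      (∀ σ ∈ CyclicBD.rotationsAndReversals m,
        CyclicBD.speed (CyclicBD.reorder σ p) = CyclicBD.speed p) ∧
      (CyclicBD.numSpeeds p : ℝ) ≤ ((m - 1)! : ℝ) / 2) ∧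
    (∀ᵐ p : Fin m → ℝ, ∀ hp : ∀ i, p i ∈ Set.Ioo (0 : ℝ) 1,
      (CyclicBD.numSpeeds (fun i => (⟨p i, hp i⟩ : Set.Ioo (0 : ℝ) 1)) : ℝ) =
        ((m - 1)! : ℝ) / 2 ∧
      ∀ σ : Equiv.Perm (Fin m),
        CyclicBD.speed (CyclicBD.reorder σ (fun i => (⟨p i, hp i⟩ : Set.Ioo (0 : ℝ) 1))) =
          CyclicBD.speed (fun i => (⟨p i, hp i⟩ : Set.Ioo (0 : ℝ) 1)) →
        σ ∈ CyclicBD.rotationsAndReversals m) := by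
  have hm0 : (0 : ℝ) < m := by exact_mod_cast (by omega : 0 < m)
  have hfac : ((m ! : ℕ) : ℝ) = m * ((m - 1)! : ℕ) := by
    exact_mod_cast (Nat.mul_factorial_pred (by omega : m ≠ 0)).symm
  refine ⟨fun p => ⟨?_, fun σ hσ => CyclicBD.speed_reorder_of_mem hm hσ p, ?_⟩, ?_⟩
  · rw [CyclicBD.speed_formula hm]
    exact CyclicBD.hasSpeed_formula hm p
  · have h : ((CyclicBD.numSpeeds p * (2 * m) : ℕ) : ℝ) ≤ (m ! : ℕ) := by
      exact_mod_cast CyclicBD.numSpeeds_mul_le hm p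
    rw [hfac] at h
    push_cast at h
    rw [le_div_iff₀ two_pos]
    refine le_of_mul_le_mul_left ?_ hm0
    linarith
  · filter_upwards [CyclicBD.ae_generic hm] with x ⟨hx, hgen⟩ hp
    set p : Fin m → Set.Ioo (0 : ℝ) 1 := fun i => ⟨x i, hp i⟩ with hpdef
    have hinj : ∀ σ τ : Equiv.Perm (Fin m),
        CyclicBD.speed (CyclicBD.reorder σ p) = CyclicBD.speed (CyclicBD.reorder τ p) →
          σ * τ⁻¹ ∈ CyclicBD.rotationsAndReversals m := by
      intro σ τ h
      by_contra hc
      refine hgen σ τ hc ?_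
      rw [CyclicBD.speed_reorder hm, CyclicBD.speed_reorder hm,
        div_eq_div_iff (CyclicBD.totalWeight_birth_pos _).ne'
          (CyclicBD.totalWeight_birth_pos _).ne'] at h
      exact (mul_left_cancel₀ (mul_ne_zero hm0.ne' hx) h).symm
    refine ⟨?_, fun σ h => ?_⟩
    · have h := ncard_range_mul_card_eq (CyclicBD.rotationsAndReversals m)
        (fun σ => CyclicBD.speed (CyclicBD.reorder σ p))
        (fun h hh g => by rw [CyclicBD.reorder_mul, CyclicBD.speed_reorder_of_mem hm hh]) hinj
      rw [CyclicBD.card_rotationsAndReversals hm, Nat.card_perm, Nat.card_fin] at h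
      have h' : ((CyclicBD.numSpeeds p * (2 * m) : ℕ) : ℝ) = (m ! : ℕ) := by exact_mod_cast h
      rw [hfac] at h'
      push_cast at h'
      rw [eq_div_iff two_ne_zero]
      refine mul_left_cancel₀ hm0.ne' ?_
      linarith
    · have h1 : CyclicBD.reorder 1 p = p := rfl
      simpa using hinj σ 1 (by rw [h1]; exact h)
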